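/- Let $\mathbb F\in\{\mathbb R,\mathbb C\}$ and let $\mathfrak X$ be a Banach space over $\mathbb F$ with a computability structure, i.e. a nonempty set of sequences in $\mathfrak X$, called the computable sequences, such that: (linear combinations) if $(x_n),(y_n)$ are computable sequences, $(\alpha_{nk}),(\beta_{nk})$ are computable double sequences of scalars and $d:\mathbb N\to\mathbb N$ is recursive, then $\bigl(\sum_{k=0}^{d(n)}(\alpha_{nk}x_k+\beta_{nk}y_k)\bigr)_n$ is computable; (limits) if $(x_{nk})$ is a computable double sequence (i.e. computable as a sequence via a recursive pairing function) that converges to $(x_n)$ as $k\to\infty$, effectively in $k$ and $n$ (i.e. there is a recursive $h$ with $\|x_{nk}-x_n\|\le 2^{-N}$ whenever $k\ge h(n,N)$), then $(x_n)$ is computable; (norms) if $(x_n)$ is computable, then $(\|x_n\|)$ is a computable sequence of real numbers. Let $\mathfrak X_{\mathrm k}$ be the set of computable elements, i.e. of those $x$ for which the constant sequence $(x,x,\dots)$ is computable; it is a vector space over the field of computable scalars. An effectively generating set (e.g.s.) is a computable sequence whose linear span is dense in $\mathfrak X$. Assume that $\mathfrak X$ is an effective Banach space, i.e. that an e.g.s.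 exists, and fix any e.g.s. $(e_n)$. Let $(a_n)$ be the standard enumeration of its rational span (coefficients in $\mathbb Q$ if $\mathbb F=\mathbb R$ and in $\mathbb Q+i\mathbb Q$ if $\mathbb F=\mathbb C$), and let $(\varphi_c)_{c\in\mathbb N}$ be the standard numbering of the partial recursive functions. The standard partial numbering $\alpha$ of $\mathfrak X_{\mathrm k}$ is defined by: $c\in\operatorname{dom}\alpha$ and $\alpha(c)=x$ iff $\varphi_c$ is total and $\|a_{\varphi_c(n)}-x\|<2^{-n}$ for all $n$. Let $T:\mathfrak X_{\mathrm k}\to\mathfrak X$ be linear (over the computable scalars). Call $T$ effective if there is a partial recursive $\varphi$ such that for every $c\in\operatorname{dom}\alpha$ the value $\varphi(c)$ is defined, lies in $\operatorname{dom}\alpha$, and satisfies $T(\alpha(c))=\alpha(\varphi(c))$. Call $T$ effectively determined if there is an e.g.s. $(e'_n)$ (not necessarily the fixed one) such that $(Te'_n)$ is a computable sequence. Then $T$ is effective if and only if $T$ is effectively determined and continuous on $\mathfrak X_{\mathrm k}$. -/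

import Mathlib

/-!
Computability structures on Banach spaces and effective operators. The scalar field `𝕜` is `ℝ` or
`ℂ`. Recursive functions are Mathlib's `Computable` and `Partrec` functions.
-/

namespace EffBanach

/-- The standard numbering of `ℚ`: the number `⟨⟨a, b⟩, c⟩` codes `(a - b) / (c + 1)`. -/
def ratOfNat (n : ℕ) : ℚ :=
  ((n.unpair.1.unpair.1 : ℚ) - (n.unpair.1.unpair.2 : ℚ)) / ((n.unpair.2 : ℚ) + 1)

/-- The standard numbering of the rational scalars: `ℚ + iℚ` for `𝕜 = ℂ`, and `ℚ` for `𝕜 = ℝ`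
(where `RCLike.I = 0`). -/
noncomputable def scalarOfNat (𝕜 : Type*) [RCLike 𝕜] (n : ℕ) : 𝕜 :=
  ((ratOfNat n.unpair.1 : ℚ) : 𝕜) + ((ratOfNat n.unpair.2 : ℚ) : 𝕜) * RCLike.I

/-- A family of scalars indexed by `ι` (`ℕ` for sequences, `ℕ × ℕ` for double sequences) is
computable if some recursive family of rational scalars approximates its `i`-th member with error
at most `2⁻ᵐ`, recursively in `i` and `m`. -/
def IsComputableFamily {𝕜 : Type*} [RCLike 𝕜] {ι : Type*} [Primcodable ι] (c : ι → 𝕜) : Prop :=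
  ∃ f : ι × ℕ → ℕ, Computable f ∧ ∀ i m, ‖c i - scalarOfNat 𝕜 (f (i, m))‖ ≤ (1 / 2 : ℝ) ^ m

/-- A scalar is computable if the constant sequence with that value is. -/
def IsComputableScalar {𝕜 : Type*} [RCLike 𝕜] (c : 𝕜) : Prop :=
  IsComputableFamily (fun _ : ℕ => c)

/-- A computability structure on a normed space: a nonempty set of sequences (the computable
sequences) that satisfies the linear combination, limit and norm axioms. -/
structure ComputabilityStructure (𝕜 : Type*) [RCLike 𝕜] (X : Type*) [NormedAddCommGroup X]
    [NormedSpace 𝕜 X] where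
  /-- The computable sequences. -/
  seqs : Set (ℕ → X)
  nonempty : seqs.Nonempty
  linear_combination : ∀ x ∈ seqs, ∀ y ∈ seqs, ∀ a b : ℕ × ℕ → 𝕜,
    IsComputableFamily a → IsComputableFamily b → ∀ d : ℕ → ℕ, Computable d →
      (fun n => ∑ k ∈ Finset.range (d n + 1), (a (n, k) • x k + b (n, k) • y k)) ∈ seqs
  /-- A double sequence is computable if it becomes a computable sequence under the standard
  pairing function; it converges effectively if it has a recursive modulus of convergence. -/
  limit : ∀ (x : ℕ → ℕ → X) (y : ℕ → X), (fun m => x m.unpair.1 m.unpair.2) ∈ seqs →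
    (∃ h : ℕ × ℕ → ℕ, Computable h ∧
      ∀ n N k, h (n, N) ≤ k → ‖x n k - y n‖ ≤ (1 / 2 : ℝ) ^ N) → y ∈ seqs
  norm : ∀ x ∈ seqs, IsComputableFamily (fun n : ℕ => ‖x n‖)

variable {𝕜 : Type*} [RCLike 𝕜] {X : Type*} [NormedAddCommGroup X] [NormedSpace 𝕜 X]

namespace ComputabilityStructure

/-- The set `X_k` of computable elements. -/
def elements (S : ComputabilityStructure 𝕜 X) : Set X :=
  {x | (fun _ : ℕ => x) ∈ S.seqs}

/-- An effectively generating set: a computable sequence whose linear span is dense. -/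
def IsEGS (S : ComputabilityStructure 𝕜 X) (e : ℕ → X) : Prop :=
  e ∈ S.seqs ∧ Dense (Submodule.span 𝕜 (Set.range e) : Set X)

end ComputabilityStructure

/-- The `c`-th partial recursive function `φ_c`. -/
def phi (c : ℕ) : ℕ →. ℕ := (Denumerable.ofNat Nat.Partrec.Code c).eval

/-- The enumeration `a₀, a₁, …` of the rational span of `e`: if `n` codes the list `l₀, …, lᵣ₋₁`,
then `aₙ` is the linear combination of `e₀, …, eᵣ₋₁` with coefficients coded by `l₀, …, lᵣ₋₁`. -/
noncomputable def ratSpan (𝕜 : Type*) [RCLike 𝕜] {X : Type*} [NormedAddCommGroup X]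
    [NormedSpace 𝕜 X] (e : ℕ → X) (n : ℕ) : X :=
  ∑ j ∈ Finset.range (Denumerable.ofNat (List ℕ) n).length,
    scalarOfNat 𝕜 ((Denumerable.ofNat (List ℕ) n).getD j 0) • e j

/-- The graph of the standard (partial) numbering `α` given by `e`: `c ∈ dom α` and `α c = x`. That
is, `φ_c` is total and `‖a_{φ_c(n)} - x‖ < 2⁻ⁿ` for all `n`, so that `x = lim a_{φ_c(n)}`. -/
def IsIndex (𝕜 : Type*) [RCLike 𝕜] {X : Type*} [NormedAddCommGroup X] [NormedSpace 𝕜 X]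
    (e : ℕ → X) (c : ℕ) (x : X) : Prop :=
  ∀ n, ∃ m ∈ phi c n, ‖ratSpan 𝕜 e m - x‖ < (1 / 2 : ℝ) ^ n

/-- The numbering is single-valued. -/
theorem IsIndex.unique {e : ℕ → X} {c : ℕ} {x y : X} (hx : IsIndex 𝕜 e c x)
    (hy : IsIndex 𝕜 e c y) : x = y := by
  rw [← sub_eq_zero, ← norm_le_zero_iff]
  have h : ∀ n : ℕ, ‖x - y‖ ≤ 2 * (1 / 2 : ℝ) ^ n := by
    intro n
    obtain ⟨m, hm, h1⟩ := hx n
    obtain ⟨m', hm', h2⟩ := hy n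
    obtain rfl := Part.mem_unique hm hm'
    have h3 : x - y = (ratSpan 𝕜 e m - y) - (ratSpan 𝕜 e m - x) := by abel
    rw [h3]
    linarith [norm_sub_le (ratSpan 𝕜 e m - y) (ratSpan 𝕜 e m - x)]
  have hl : Filter.Tendsto (fun n : ℕ => 2 * (1 / 2 : ℝ) ^ n) Filter.atTop (nhds (2 * 0)) :=
    (tendsto_pow_atTop_nhds_zero_of_lt_one (by norm_num) (by norm_num)).const_mul 2
  rw [mul_zero] at hl
  exact ge_of_tendsto' hl h

namespace ComputabilityStructure

/-- Linearity of an operator defined on `X_k`, which is a vector space over the computable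
scalars. -/
structure IsLinear (S : ComputabilityStructure 𝕜 X) (T : S.elements → X) : Prop where
  add : ∀ x y z : S.elements, (z : X) = x + y → T z = T x + T y
  smul : ∀ (c : 𝕜) (x z : S.elements), IsComputableScalar c → (z : X) = c • (x : X) →
    T z = c • T x

/-- `T` is effective with respect to the standard numbering `α` given by `e`: some partial recursive
`φ` satisfies `T (α c) = α (φ c)` for all `c ∈ dom α` (in particular `φ c` is defined and lies in
`dom α`). -/
def IsEffective (S : ComputabilityStructure 𝕜 X) (e : ℕ → X) (T : S.elements → X) : Prop :=
  ∃ φ : ℕ →. ℕ, Partrec φ ∧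
    ∀ (c : ℕ) (x : S.elements), IsIndex 𝕜 e c (x : X) → ∃ d ∈ φ c, IsIndex 𝕜 e d (T x)

/-- `T` is effectively determined: it maps some effectively generating set to a computable
sequence. -/
def IsEffectivelyDetermined (S : ComputabilityStructure 𝕜 X) (T : S.elements → X) : Prop :=
  ∃ e : ℕ → S.elements, S.IsEGS (fun n => (e n : X)) ∧ (fun n => T (e n)) ∈ S.seqs

end ComputabilityStructure

end EffBanach

/-! Write `a` for the rational span of `e`. If `T` is effective, the constant function with value
`m` is an index of `a_m`, so indices of all `T a_m` are computable uniformly in `m`. By the limit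
axiom `(T a_m)` is a computable sequence, and so is its subsequence `(T e_n)`.

Continuity follows from a Kreisel–Lacombe–Shoenfield argument (`IsEffective.exists_modulus`). If the
images of rational points tending to `x` stay away from `T x`, such points can be found by search,
since strict inequalities between computable reals are semidecidable. The recursion theorem gives a
program that lists approximations to `x` until the operator, applied to this very program, commits
itself to a value near `T x`; the program then switches to a rational point near `x` whose image is
far from `T x`. The operator must commit itself, and is then wrong.

Conversely, a continuous linear `T` is bounded (`IsLinear.exists_bound`). Given an index of `x`,
replace each approximation by a rational combination of the `e'_n`; its image is the same
combination of the `T e'_n`, hence computable, and the bound controls its distance from `T x`. -/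

namespace EffBanach

/-! ### Semidecidable predicates and effective search. -/

section Semidecidable

variable {α β σ : Type*} [Primcodable α] [Primcodable β] [Primcodable σ]

/-- A predicate is semidecidable if it is the projection of a recursive predicate. -/
def IsSemidecidable (P : α → Prop) : Prop :=
  ∃ D : α × ℕ → Bool, Computable D ∧ ∀ a, P a ↔ ∃ s, D (a, s) = true

theorem IsSemidecidable.comp {P : β → Prop} (hP : IsSemidecidable P) {f : α → β}
    (hf : Computable f) : IsSemidecidable fun a => P (f a) := by
  obtain ⟨D, hD, h⟩ := hP
  exact ⟨fun p => D (f p.1, p.2), hD.comp ((hf.comp Computable.fst).pair Computable.snd),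
    fun a => h (f a)⟩

theorem IsSemidecidable.and {P Q : α → Prop} (hP : IsSemidecidable P) (hQ : IsSemidecidable Q) :
    IsSemidecidable fun a => P a ∧ Q a := by
  obtain ⟨D, hD, hPD⟩ := hP
  obtain ⟨E, hE, hQE⟩ := hQ
  have h1 : Computable fun p : α × ℕ => p.2.unpair.1 :=
    Computable.fst.comp (Computable.unpair.comp Computable.snd)
  have h2 : Computable fun p : α × ℕ => p.2.unpair.2 :=
    Computable.snd.comp (Computable.unpair.comp Computable.snd)
  refine ⟨fun p => D (p.1, p.2.unpair.1) && E (p.1, p.2.unpair.2),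
    Primrec.and.to_comp.comp (hD.comp (Computable.fst.pair h1))
      (hE.comp (Computable.fst.pair h2)), fun a => ?_⟩
  beta_reduce
  rw [hPD, hQE]
  constructor
  · rintro ⟨⟨s, hs⟩, ⟨t, ht⟩⟩
    exact ⟨Nat.pair s t, by simp [hs, ht]⟩
  · rintro ⟨s, hs⟩
    simp only [Bool.and_eq_true] at hs
    exact ⟨⟨_, hs.1⟩, ⟨_, hs.2⟩⟩

theorem IsSemidecidable.of_partrec {F : α →. σ} (hF : Partrec F) :
    IsSemidecidable fun a => (F a).Dom := by
  obtain ⟨c, hc⟩ := Nat.Partrec.Code.exists_code.1 hF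
  refine ⟨fun p => (Nat.Partrec.Code.evaln p.2 c (Encodable.encode p.1)).isSome, ?_, fun a => ?_⟩
  · exact Primrec.option_isSome.to_comp.comp (Nat.Partrec.Code.primrec_evaln.to_comp.comp
      ((Computable.snd.pair (Computable.const c)).pair (Computable.encode.comp Computable.fst)))
  · have h1 : (F a).Dom ↔ (c.eval (Encodable.encode a)).Dom := by
      rw [hc]; simp
    refine h1.trans ?_
    constructor
    · intro h
      obtain ⟨k, hk⟩ := Nat.Partrec.Code.evaln_complete.1 (Part.get_mem h)
      exact ⟨k, Option.isSome_iff_exists.2 ⟨_, hk⟩⟩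
    · rintro ⟨k, hk⟩
      obtain ⟨v, hv⟩ := Option.isSome_iff_exists.1 hk
      exact Part.dom_iff_mem.2 ⟨v, Nat.Partrec.Code.evaln_complete.2 ⟨k, hv⟩⟩

theorem IsSemidecidable.exists_mem {Q : β → Prop} (hQ : IsSemidecidable Q) {F : α →. β}
    (hF : Partrec F) : IsSemidecidable fun a => ∃ v ∈ F a, Q v := by
  obtain ⟨D, hD, h⟩ := hQ
  have hG : Partrec fun v : β => Nat.rfind fun s => Part.some (D (v, s)) :=
    Partrec.rfind (Computable.partrec hD : Partrec fun p : β × ℕ => Part.some (D p)).to₂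
  -- Evaluating `F` and then searching for a witness of `Q` halts exactly when the value exists and
  -- satisfies `Q`.
  obtain ⟨E, hE, hE'⟩ := IsSemidecidable.of_partrec (hF.bind (hG.comp Computable.snd).to₂)
  refine ⟨E, hE, fun a => ?_⟩
  refine Iff.trans (Iff.trans ?_ Part.dom_iff_mem.symm) (hE' a)
  simp only [Part.mem_bind_iff]
  constructor
  · rintro ⟨v, hv, hq⟩
    obtain ⟨s, hs⟩ := (h v).1 hq
    obtain ⟨n, hn, -⟩ := Nat.rfind_min' (p := fun s => D (v, s)) hs
    exact ⟨n, v, hv, hn⟩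
  · rintro ⟨n, v, hv, hn⟩
    exact ⟨v, hv, (h v).2 ⟨n, by simpa using (Nat.rfind_spec hn)⟩⟩

/-- Effective choice for semidecidable relations. -/
theorem IsSemidecidable.exists_computable {R : α × ℕ → Prop} (hR : IsSemidecidable R)
    (h : ∀ a, ∃ m, R (a, m)) : ∃ f : α → ℕ, Computable f ∧ ∀ a, R (a, f a) := by
  obtain ⟨D, hD, hRD⟩ := hR
  -- The search runs over pairs of a candidate and a stage, so no single candidate can block it.
  have hE : Computable fun p : α × ℕ => D ((p.1, p.2.unpair.1), p.2.unpair.2) :=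
    hD.comp ((Computable.fst.pair (Computable.fst.comp (Computable.unpair.comp
      Computable.snd))).pair (Computable.snd.comp (Computable.unpair.comp Computable.snd)))
  have hG : Partrec fun a : α => Nat.rfind fun s => Part.some (D ((a, s.unpair.1), s.unpair.2)) :=
    Partrec.rfind (Computable.partrec hE).to₂
  have hex : ∀ a, ∃ n, n ∈ Nat.rfind fun s => Part.some (D ((a, s.unpair.1), s.unpair.2)) := by
    intro a
    obtain ⟨m, hm⟩ := h a
    obtain ⟨s, hs⟩ := (hRD _).1 hm
    obtain ⟨n, hn, -⟩ := Nat.rfind_min' (p := fun s => D ((a, s.unpair.1), s.unpair.2))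
      (m := Nat.pair m s) (by simpa using hs)
    exact ⟨n, hn⟩
  choose g hg using hex
  refine ⟨fun a => (g a).unpair.1,
    Computable.fst.comp (Computable.unpair.comp (hG.of_eq_tot hg)), fun a => ?_⟩
  exact (hRD _).2 ⟨(g a).unpair.2, by simpa using Nat.rfind_spec (hg a)⟩

end Semidecidable

/-! ### Comparing computable reals with powers of two. -/

theorem primrec_two_pow : Primrec fun n : ℕ => 2 ^ n :=
  (Primrec.nat_rec₁ 1 (Primrec.nat_mul.comp Primrec.snd (Primrec.const 2)).to₂).of_eq fun n => by
    induction n with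
    | zero => rfl
    | succ n ih => simp only [pow_succ]; rw [← ih]

theorem scalarOfNat_real (n : ℕ) : scalarOfNat ℝ n = ratOfNat n.unpair.1 := by
  simp [scalarOfNat]

section Compare

variable {ι : Type*} [Primcodable ι]

theorem computable_numerators {f : ι × ℕ → ℕ} (hf : Computable f) :
    Computable (fun p : (ι × ℕ) × ℕ => (f (p.1.1, p.2)).unpair.1.unpair.1.unpair.1) ∧
    Computable (fun p : (ι × ℕ) × ℕ => (f (p.1.1, p.2)).unpair.1.unpair.1.unpair.2) ∧
    Computable (fun p : (ι × ℕ) × ℕ => (f (p.1.1, p.2)).unpair.1.unpair.2 + 1) := by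
  have h0 : Computable fun p : (ι × ℕ) × ℕ => (f (p.1.1, p.2)).unpair.1 :=
    Computable.fst.comp (Computable.unpair.comp
      (hf.comp ((Computable.fst.comp Computable.fst).pair Computable.snd)))
  have h1 := Computable.unpair.comp h0
  have h2 := Computable.unpair.comp (Computable.fst.comp h1)
  exact ⟨Computable.fst.comp h2, Computable.snd.comp h2,
    Computable.succ.comp (Computable.snd.comp h1)⟩

/-- Multiplying by the denominator times `2 ^ (m + k)` and moving the negative terms across leaves a
decidable comparison of natural numbers. -/
theorem ratOfNat_lt_iff (n m k : ℕ) :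
    ((ratOfNat n : ℚ) : ℝ) + (1 / 2) ^ m < (1 / 2) ^ k ↔
      n.unpair.1.unpair.1 * 2 ^ (m + k) + (n.unpair.2 + 1) * 2 ^ k <
        n.unpair.1.unpair.2 * 2 ^ (m + k) + (n.unpair.2 + 1) * 2 ^ m := by
  have hc : (0 : ℝ) < (n.unpair.2 : ℝ) + 1 := by positivity
  rw [← Nat.cast_lt (α := ℝ), ← mul_lt_mul_iff_of_pos_right
    (show (0 : ℝ) < (n.unpair.2 + 1) * 2 ^ (m + k) by positivity)]
  simp only [ratOfNat]
  push_cast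
  have e1 : (1 / 2 : ℝ) ^ m * 2 ^ m = 1 := by rw [← mul_pow]; norm_num
  have e2 : (1 / 2 : ℝ) ^ k * 2 ^ k = 1 := by rw [← mul_pow]; norm_num
  have e3 : (((n.unpair.1.unpair.1 : ℝ) - n.unpair.1.unpair.2) / (n.unpair.2 + 1) + (1 / 2) ^ m) *
      ((n.unpair.2 + 1) * 2 ^ (m + k)) = ((n.unpair.1.unpair.1 : ℝ) - n.unpair.1.unpair.2) *
        2 ^ (m + k) + (n.unpair.2 + 1) * 2 ^ k := by
    rw [add_mul, ← mul_assoc (_ / _), div_mul_cancel₀ _ hc.ne', pow_add]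
    linear_combination ((n.unpair.2 : ℝ) + 1) * 2 ^ k * e1
  have e4 : (1 / 2 : ℝ) ^ k * ((n.unpair.2 + 1) * 2 ^ (m + k)) = (n.unpair.2 + 1) * 2 ^ m := by
    rw [pow_add]
    linear_combination ((n.unpair.2 : ℝ) + 1) * 2 ^ m * e2
  rw [e3, e4]
  constructor <;> intro h <;> linarith

theorem lt_ratOfNat_iff (n m k : ℕ) :
    (1 / 2) ^ k + (1 / 2) ^ m < ((ratOfNat n : ℚ) : ℝ) ↔
      n.unpair.1.unpair.2 * 2 ^ (m + k) + (n.unpair.2 + 1) * 2 ^ k + (n.unpair.2 + 1) * 2 ^ m <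
        n.unpair.1.unpair.1 * 2 ^ (m + k) := by
  have hc : (0 : ℝ) < (n.unpair.2 : ℝ) + 1 := by positivity
  rw [← Nat.cast_lt (α := ℝ), ← mul_lt_mul_iff_of_pos_right
    (show (0 : ℝ) < (n.unpair.2 + 1) * 2 ^ (m + k) by positivity)]
  simp only [ratOfNat]
  push_cast
  have e1 : (1 / 2 : ℝ) ^ m * 2 ^ m = 1 := by rw [← mul_pow]; norm_num
  have e2 : (1 / 2 : ℝ) ^ k * 2 ^ k = 1 := by rw [← mul_pow]; norm_num
  have e3 : ((n.unpair.1.unpair.1 : ℝ) - n.unpair.1.unpair.2) / (n.unpair.2 + 1) *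
      ((n.unpair.2 + 1) * 2 ^ (m + k)) = ((n.unpair.1.unpair.1 : ℝ) - n.unpair.1.unpair.2) *
        2 ^ (m + k) := by
    rw [← mul_assoc (_ / _), div_mul_cancel₀ _ hc.ne']
  have e4 : ((1 / 2 : ℝ) ^ k + (1 / 2) ^ m) * ((n.unpair.2 + 1) * 2 ^ (m + k)) =
      (n.unpair.2 + 1) * 2 ^ m + (n.unpair.2 + 1) * 2 ^ k := by
    rw [pow_add]
    linear_combination ((n.unpair.2 : ℝ) + 1) * 2 ^ m * e2 + ((n.unpair.2 : ℝ) + 1) * 2 ^ k * e1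
  rw [e3, e4]
  constructor <;> intro h <;> linarith

/-- The inequality holds iff some approximation lies below the bound by more than its own error
`2⁻ᵐ`. As the approximation may itself exceed `r` by `2⁻ᵐ`, this is certain once `2⁻ᵐ` is less than
half the gap. -/
theorem IsComputableFamily.semidecidable_lt {r : ι → ℝ} (hr : IsComputableFamily r) :
    IsSemidecidable fun p : ι × ℕ => r p.1 < (1 / 2) ^ p.2 := by
  obtain ⟨f, hf, happ⟩ := hr
  simp only [scalarOfNat_real, Real.norm_eq_abs, abs_le] at happ
  obtain ⟨ha, hb, hc⟩ := computable_numerators hf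
  have hm := primrec_two_pow.to_comp.comp (Computable.snd (α := ι × ℕ) (β := ℕ))
  have hk := primrec_two_pow.to_comp.comp
    (Computable.snd.comp (Computable.fst (α := ι × ℕ) (β := ℕ)))
  have hmk := primrec_two_pow.to_comp.comp (Primrec.nat_add.to_comp.comp
    (Computable.snd (α := ι × ℕ) (β := ℕ))
    (Computable.snd.comp (Computable.fst (α := ι × ℕ) (β := ℕ))))
  have hmul := Primrec.nat_mul.to_comp
  have hadd := Primrec.nat_add.to_comp
  refine ⟨_, Primrec.nat_lt.decide.to_comp.comp (hadd.comp (hmul.comp ha hmk) (hmul.comp hc hk))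
    (hadd.comp (hmul.comp hb hmk) (hmul.comp hc hm)), fun p => ?_⟩
  simp only [decide_eq_true_eq, ← ratOfNat_lt_iff]
  constructor
  · intro h
    obtain ⟨m, hm⟩ := exists_pow_lt_of_lt_one (half_pos (sub_pos.2 h))
      (show (1 / 2 : ℝ) < 1 by norm_num)
    exact ⟨m, by linarith [happ p.1 m]⟩
  · rintro ⟨m, hm⟩
    linarith [happ p.1 m]

theorem IsComputableFamily.semidecidable_gt {r : ι → ℝ} (hr : IsComputableFamily r) :
    IsSemidecidable fun p : ι × ℕ => (1 / 2) ^ p.2 < r p.1 := by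
  obtain ⟨f, hf, happ⟩ := hr
  simp only [scalarOfNat_real, Real.norm_eq_abs, abs_le] at happ
  obtain ⟨ha, hb, hc⟩ := computable_numerators hf
  have hm := primrec_two_pow.to_comp.comp (Computable.snd (α := ι × ℕ) (β := ℕ))
  have hk := primrec_two_pow.to_comp.comp
    (Computable.snd.comp (Computable.fst (α := ι × ℕ) (β := ℕ)))
  have hmk := primrec_two_pow.to_comp.comp (Primrec.nat_add.to_comp.comp
    (Computable.snd (α := ι × ℕ) (β := ℕ))
    (Computable.snd.comp (Computable.fst (α := ι × ℕ) (β := ℕ))))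
  have hmul := Primrec.nat_mul.to_comp
  have hadd := Primrec.nat_add.to_comp
  refine ⟨_, Primrec.nat_lt.decide.to_comp.comp
    (hadd.comp (hadd.comp (hmul.comp hb hmk) (hmul.comp hc hk)) (hmul.comp hc hm))
    (hmul.comp ha hmk), fun p => ?_⟩
  simp only [decide_eq_true_eq, ← lt_ratOfNat_iff]
  constructor
  · intro h
    obtain ⟨m, hm⟩ := exists_pow_lt_of_lt_one (half_pos (sub_pos.2 h))
      (show (1 / 2 : ℝ) < 1 by norm_num)
    exact ⟨m, by linarith [happ p.1 m]⟩
  · rintro ⟨m, hm⟩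
    linarith [happ p.1 m]

end Compare

/-- The number of the scalar `a - b`. -/
def scalarCode (a b : ℕ) : ℕ :=
  Nat.pair (Nat.pair (Nat.pair a b) 0) 0

/-! ### Codes and density of the rational scalars. -/

section Scalars

variable {𝕜 : Type*} [RCLike 𝕜]

theorem ratOfNat_zero : ratOfNat 0 = 0 := by
  simp [ratOfNat]

theorem scalarOfNat_zero : scalarOfNat 𝕜 0 = 0 := by
  simp [scalarOfNat, ratOfNat_zero]

theorem scalarOfNat_scalarCode (a b : ℕ) : scalarOfNat 𝕜 (scalarCode a b) = a - b := by
  simp [scalarOfNat, scalarCode, ratOfNat_zero]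
  simp [ratOfNat]

theorem isComputableFamily_scalarOfNat {ι : Type*} [Primcodable ι] {g : ι → ℕ}
    (hg : Computable g) : IsComputableFamily fun i => scalarOfNat 𝕜 (g i) :=
  ⟨fun p => g p.1, hg.comp Computable.fst, fun i m => by simp⟩

theorem isComputableScalar_scalarOfNat (n : ℕ) : IsComputableScalar (scalarOfNat 𝕜 n) :=
  isComputableFamily_scalarOfNat (Computable.const n)

theorem isComputableFamily_ite {f : ℕ → ℕ} (hf : Computable f) (a b : ℕ) :
    IsComputableFamily fun p : ℕ × ℕ => if p.2 = f p.1 then (a - b : 𝕜) else 0 := by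
  have h : Computable fun p : ℕ × ℕ => bif decide (p.2 = f p.1) then scalarCode a b else 0 :=
    Computable.cond (Primrec.eq.decide.to_comp.comp Computable.snd (hf.comp Computable.fst))
      (Computable.const _) (Computable.const _)
  convert isComputableFamily_scalarOfNat (𝕜 := 𝕜) h using 2 with p
  by_cases hp : p.2 = f p.1 <;> simp [hp, scalarOfNat_scalarCode, scalarOfNat_zero]

theorem ratOfNat_surjective : Function.Surjective ratOfNat := by
  intro q
  refine ⟨Nat.pair (Nat.pair q.num.toNat (-q.num).toNat) (q.den - 1), ?_⟩
  have h1 : ((q.num.toNat : ℚ) - ((-q.num).toNat : ℚ)) = q.num := by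
    exact_mod_cast congrArg (Int.cast : ℤ → ℚ) (Int.toNat_sub_toNat_neg q.num)
  have h2 : ((q.den - 1 : ℕ) : ℚ) + 1 = q.den := by
    exact_mod_cast Nat.sub_add_cancel q.den_pos
  simp only [ratOfNat, Nat.unpair_pair, h1, h2, Rat.num_div_den]

theorem exists_scalarOfNat_near (z : 𝕜) {ε : ℝ} (hε : 0 < ε) :
    ∃ n, ‖scalarOfNat 𝕜 n - z‖ < ε := by
  obtain ⟨p, hp1, hp2⟩ := exists_rat_btwn (show RCLike.re z < RCLike.re z + ε / 2 by linarith)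
  obtain ⟨q, hq1, hq2⟩ := exists_rat_btwn (show RCLike.im z < RCLike.im z + ε / 2 by linarith)
  obtain ⟨m, rfl⟩ := ratOfNat_surjective p
  obtain ⟨n, rfl⟩ := ratOfNat_surjective q
  refine ⟨Nat.pair m n, ?_⟩
  have h : scalarOfNat 𝕜 (Nat.pair m n) - z =
      (((ratOfNat m : ℝ) - RCLike.re z : ℝ) : 𝕜) +
        (((ratOfNat n : ℝ) - RCLike.im z : ℝ) : 𝕜) * RCLike.I := by
    conv_lhs => rw [← RCLike.re_add_im z]
    simp only [scalarOfNat, Nat.unpair_pair]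
    push_cast
    ring
  have hI : ‖(RCLike.I : 𝕜)‖ ≤ 1 := by
    by_cases hI : (RCLike.I : 𝕜) = 0
    · simp [hI]
    · exact (RCLike.norm_I_of_ne_zero hI).le
  have h1 : |(ratOfNat m : ℝ) - RCLike.re z| < ε / 2 := by rw [abs_lt]; constructor <;> linarith
  have h2 : |(ratOfNat n : ℝ) - RCLike.im z| < ε / 2 := by rw [abs_lt]; constructor <;> linarith
  rw [h]
  refine (norm_add_le _ _).trans_lt ?_
  rw [norm_mul, RCLike.norm_ofReal, RCLike.norm_ofReal]
  have h3 := mul_le_mul_of_nonneg_left hI (abs_nonneg ((ratOfNat n : ℝ) - RCLike.im z))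
  linarith

end Scalars

/-! ### Codes and density of the rational span. -/

section RatSpan

variable {𝕜 : Type*} [RCLike 𝕜] {X : Type*} [NormedAddCommGroup X] [NormedSpace 𝕜 X]

theorem ratSpan_encode (e : ℕ → X) (l : List ℕ) :
    ratSpan 𝕜 e (Encodable.encode l) =
      ∑ j ∈ Finset.range l.length, scalarOfNat 𝕜 (l.getD j 0) • e j := by
  simp only [ratSpan, Denumerable.ofNat_encode]

/-- The number of `e n` in the enumeration of the rational span of `e`. -/
def basisCode (n : ℕ) : ℕ :=
  Encodable.encode ((List.range n).map (fun _ => 0) ++ [scalarCode 1 0])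

theorem computable_basisCode : Computable basisCode :=
  (Primrec.encode.comp (Primrec.list_append.comp
    (Primrec.list_map Primrec.list_range (Primrec.const 0).to₂)
    (Primrec.const [scalarCode 1 0]))).to_comp

theorem ratSpan_basisCode (e : ℕ → X) (n : ℕ) : ratSpan 𝕜 e (basisCode n) = e n := by
  rw [basisCode, ratSpan_encode]
  simp only [List.length_append, List.length_map, List.length_range, List.length_singleton]
  rw [Finset.sum_range_succ, Finset.sum_eq_zero, zero_add]
  · simp [List.getD, scalarOfNat_scalarCode]
  · intro j hj
    have hj : j < n := Finset.mem_range.1 hj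
    simp [List.getD, List.getElem?_append, hj, scalarOfNat_zero]

theorem exists_ratSpan_eq (𝕜 : Type*) [RCLike 𝕜] [NormedSpace 𝕜 X] (e : ℕ → X) (N : ℕ)
    (c : ℕ → ℕ) : ∃ n, ratSpan 𝕜 e n = ∑ j ∈ Finset.range N, scalarOfNat 𝕜 (c j) • e j := by
  refine ⟨Encodable.encode ((List.range N).map c), ?_⟩
  rw [ratSpan_encode]
  simp only [List.length_map, List.length_range]
  refine Finset.sum_congr rfl fun j hj => ?_
  simp [List.getD, Finset.mem_range.1 hj]

theorem exists_ratSpan_near_sum (e : ℕ → X) (N : ℕ) (a : ℕ → 𝕜) {ε : ℝ} (hε : 0 < ε) :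
    ∃ n, ‖ratSpan 𝕜 e n - ∑ j ∈ Finset.range N, a j • e j‖ < ε := by
  -- The added `1` keeps the denominator positive when all `e j` vanish.
  have hpos : 0 < ∑ j ∈ Finset.range N, ‖e j‖ + 1 := by positivity
  choose c hc using fun j => exists_scalarOfNat_near (a j) (div_pos hε hpos)
  obtain ⟨n, hn⟩ := exists_ratSpan_eq 𝕜 e N c
  refine ⟨n, ?_⟩
  rw [hn, ← Finset.sum_sub_distrib]
  calc ‖∑ j ∈ Finset.range N, (scalarOfNat 𝕜 (c j) • e j - a j • e j)‖
      ≤ ∑ j ∈ Finset.range N, ε / (∑ j ∈ Finset.range N, ‖e j‖ + 1) * ‖e j‖ := by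
        refine norm_sum_le_of_le _ fun j _ => ?_
        rw [← sub_smul, norm_smul]
        exact mul_le_mul_of_nonneg_right (hc j).le (norm_nonneg _)
    _ < ε / (∑ j ∈ Finset.range N, ‖e j‖ + 1) * (∑ j ∈ Finset.range N, ‖e j‖ + 1) := by
        rw [← Finset.mul_sum]
        exact mul_lt_mul_of_pos_left (lt_add_one _) (div_pos hε hpos)
    _ = ε := div_mul_cancel₀ _ hpos.ne'

theorem exists_ratSpan_near {e : ℕ → X}
    (he : Dense (Submodule.span 𝕜 (Set.range e) : Set X)) (x : X) {ε : ℝ} (hε : 0 < ε) :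
    ∃ n, ‖ratSpan 𝕜 e n - x‖ < ε := by
  obtain ⟨y, hy, hxy⟩ := Metric.dense_iff.1 he x (ε / 2) (half_pos hε)
  obtain ⟨a, rfl⟩ := Finsupp.mem_span_range_iff_exists_finsupp.1 hxy
  obtain ⟨N, hN⟩ := a.support.exists_nat_subset_range
  have hsum : (a.sum fun i c => c • e i) = ∑ j ∈ Finset.range N, a j • e j :=
    Finsupp.sum_of_support_subset a hN _ (by simp)
  obtain ⟨n, hn⟩ := exists_ratSpan_near_sum e N a (half_pos hε)
  refine ⟨n, ?_⟩
  rw [hsum, Metric.mem_ball, dist_eq_norm] at hy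
  calc ‖ratSpan 𝕜 e n - x‖ ≤ ‖ratSpan 𝕜 e n - ∑ j ∈ Finset.range N, a j • e j‖ +
        ‖∑ j ∈ Finset.range N, a j • e j - x‖ := norm_sub_le_norm_sub_add_norm_sub _ _ _
    _ < ε := by linarith

end RatSpan

/-! ### Closure properties of computable sequences. -/

namespace ComputabilityStructure

variable {𝕜 : Type*} [RCLike 𝕜] {X : Type*} [NormedAddCommGroup X] [NormedSpace 𝕜 X]
  {S : ComputabilityStructure 𝕜 X} {x y e : ℕ → X}

theorem seqs_comp (hx : x ∈ S.seqs) {f : ℕ → ℕ} (hf : Computable f) :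
    (fun n => x (f n)) ∈ S.seqs := by
  convert S.linear_combination x hx x hx _ _ (isComputableFamily_ite hf 1 0)
    (isComputableFamily_ite hf 0 0) f hf using 2 with n
  simp

theorem seqs_sub (hx : x ∈ S.seqs) (hy : y ∈ S.seqs) : (fun n => x n - y n) ∈ S.seqs := by
  convert S.linear_combination x hx y hy _ _ (isComputableFamily_ite Computable.id 1 0)
    (isComputableFamily_ite Computable.id 0 1) id Computable.id using 2 with n
  simp [Finset.sum_add_distrib, sub_eq_add_neg]

theorem ratSpan_mem_seqs (he : e ∈ S.seqs) : ratSpan 𝕜 e ∈ S.seqs := by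
  have hl : Computable fun p : ℕ × ℕ => (Denumerable.ofNat (List ℕ) p.1).getD p.2 0 :=
    (Primrec.list_getD 0).to_comp.comp ((Computable.ofNat (List ℕ)).comp Computable.fst)
      Computable.snd
  -- The axiom sums one term past the end of the list; there `getD` returns `0`, which codes the
  -- scalar `0`.
  convert S.linear_combination e he e he _ _ (isComputableFamily_scalarOfNat hl)
    (isComputableFamily_ite Computable.id 0 0) _
    (Computable.list_length.comp (Computable.ofNat (List ℕ))) using 2 with n
  simp [Finset.sum_range_succ, ratSpan, scalarOfNat_zero]

theorem mem_elements (hx : x ∈ S.seqs) (n : ℕ) : x n ∈ S.elements :=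
  seqs_comp hx (Computable.const n)

/-- The distances between the members of two computable sequences form a computable family. -/
theorem isComputableFamily_dist (hx : x ∈ S.seqs) (hy : y ∈ S.seqs) :
    IsComputableFamily fun p : ℕ × ℕ => ‖x p.1 - y p.2‖ := by
  obtain ⟨f, hf, happ⟩ := S.norm _ (seqs_sub
    (seqs_comp hx (Computable.fst.comp Computable.unpair))
    (seqs_comp hy (Computable.snd.comp Computable.unpair)))
  refine ⟨fun p => f (Nat.pair p.1.1 p.1.2, p.2), hf.comp
    ((Primrec₂.natPair.to_comp.comp (Computable.fst.comp Computable.fst)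
      (Computable.snd.comp Computable.fst)).pair Computable.snd), fun p m => ?_⟩
  simpa using happ (Nat.pair p.1 p.2) m

/-- A computable sequence can be approximated recursively from the rational span of an effectively
generating set. -/
theorem IsEGS.exists_approx (he : S.IsEGS e) (hx : x ∈ S.seqs) :
    ∃ g : ℕ × ℕ → ℕ, Computable g ∧ ∀ n k, ‖ratSpan 𝕜 e (g (n, k)) - x n‖ < (1 / 2) ^ k := by
  have h := (isComputableFamily_dist (ratSpan_mem_seqs he.1) hx).semidecidable_lt
  have h' : IsSemidecidable fun p : (ℕ × ℕ) × ℕ =>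
      ‖ratSpan 𝕜 e p.2 - x p.1.1‖ < (1 / 2) ^ p.1.2 :=
    h.comp (f := fun p : (ℕ × ℕ) × ℕ => ((p.2, p.1.1), p.1.2))
      ((Computable.snd.pair (Computable.fst.comp Computable.fst)).pair
        (Computable.snd.comp Computable.fst))
  -- Density guarantees that the search succeeds.
  obtain ⟨g, hg, hg'⟩ := h'.exists_computable fun p =>
    exists_ratSpan_near he.2 (x p.1) (pow_pos one_half_pos p.2)
  exact ⟨g, hg, fun n k => hg' (n, k)⟩

end ComputabilityStructure

/-! ### Indices of partial recursive functions, and first stages. -/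

theorem partrec_phi : Partrec₂ phi :=
  Nat.Partrec.Code.eval_part.comp₂ ((Computable.ofNat Nat.Partrec.Code).comp Computable.fst)
    Computable.snd

/-- The s-m-n theorem: currying a code for the uncurried function is recursive. -/
theorem exists_index_computable {F : ℕ → ℕ →. ℕ} (hF : Partrec₂ F) :
    ∃ f : ℕ → ℕ, Computable f ∧ ∀ c, phi (f c) = F c := by
  obtain ⟨c₀, hc₀⟩ := Nat.Partrec.Code.exists_code.1 (Partrec₂.unpaired'.2 hF)
  refine ⟨fun c => Encodable.encode (Nat.Partrec.Code.curry c₀ c), Computable.encode.comp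
    (Nat.Partrec.Code.primrec₂_curry.to_comp.comp (Computable.const c₀) Computable.id),
    fun c => funext fun n => ?_⟩
  simp [phi, Nat.Partrec.Code.eval_curry, hc₀]

theorem exists_const_index : ∃ f : ℕ → ℕ, Computable f ∧ ∀ c n, phi (f c) n = Part.some c := by
  obtain ⟨f, hf, h⟩ := exists_index_computable
    (F := fun c _ => Part.some c) (Computable.fst (α := ℕ) (β := ℕ)).partrec.to₂
  exact ⟨f, hf, fun c n => by rw [h]⟩

/-- The first stage below `n` at which `D` holds. -/
def firstStage (D : ℕ → Bool) (n : ℕ) : Option ℕ :=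
  n.rec none fun t o => o.casesOn (bif D t then some t else none) some

theorem firstStage_succ (D : ℕ → Bool) (n : ℕ) : firstStage D (n + 1) =
    (firstStage D n).casesOn (bif D n then some n else none) some := rfl

theorem firstStage_of_le {D : ℕ → Bool} {n t : ℕ} (h : firstStage D n = some t) {m : ℕ}
    (hm : n ≤ m) : firstStage D m = some t := by
  induction m, hm using Nat.le_induction with
  | base => exact h
  | succ m _ ih => rw [firstStage_succ, ih]

theorem firstStage_lt {D : ℕ → Bool} {n t : ℕ} (h : firstStage D n = some t) :
    t < n ∧ D t = true ∧ firstStage D (t + 1) = some t := by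
  induction n with
  | zero => simp [firstStage] at h
  | succ n ih =>
    rw [firstStage_succ] at h
    cases h' : firstStage D n with
    | some s =>
      rw [h'] at h
      obtain rfl : s = t := by simpa using h
      exact ⟨(ih h').1.trans (Nat.lt_succ_self n), (ih h').2⟩
    | none =>
      rw [h'] at h
      cases hD : D n with
      | false => simp [hD] at h
      | true =>
        obtain rfl : n = t := by simpa [hD] using h
        exact ⟨Nat.lt_succ_self n, hD, by rw [firstStage_succ, h', hD]; rfl⟩

theorem exists_firstStage {D : ℕ → Bool} {s : ℕ} (h : D s = true) :
    ∃ t, firstStage D (s + 1) = some t := by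
  cases h' : firstStage D s with
  | some t => exact ⟨t, firstStage_of_le h' (Nat.le_succ s)⟩
  | none => exact ⟨s, by rw [firstStage_succ, h', h]; rfl⟩

theorem computable_firstStage {α : Type*} [Primcodable α] {D : α × ℕ → Bool} (hD : Computable D) :
    Computable fun p : α × ℕ => firstStage (fun s => D (p.1, s)) p.2 := by
  have h1 : Computable fun q : (α × ℕ) × (ℕ × Option ℕ) =>
      bif D (q.1.1, q.2.1) then some q.2.1 else none :=
    Computable.cond (hD.comp ((Computable.fst.comp Computable.fst).pair
      (Computable.fst.comp Computable.snd)))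
      (Computable.option_some.comp (Computable.fst.comp Computable.snd)) (Computable.const none)
  have h2 : Computable fun q : (α × ℕ) × (ℕ × Option ℕ) =>
      (q.2.2.casesOn (bif D (q.1.1, q.2.1) then some q.2.1 else none) some : Option ℕ) :=
    Computable.option_casesOn (Computable.snd.comp Computable.snd) h1
      (Computable.option_some.comp Computable.snd).to₂
  exact Computable.nat_rec Computable.snd (Computable.const none) h2.to₂

/-! ### Effective operators are effectively determined and continuous. -/

namespace ComputabilityStructure

variable {𝕜 : Type*} [RCLike 𝕜] {X : Type*} [NormedAddCommGroup X] [NormedSpace 𝕜 X]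
  {S : ComputabilityStructure 𝕜 X} {e : ℕ → X} {T : S.elements → X}

/-- An effective operator maps the enumeration of the rational span to a computable sequence. -/
theorem IsEffective.ratSpan_mem_seqs (h : S.IsEffective e T) (he : e ∈ S.seqs) :
    (fun n => T ⟨ratSpan 𝕜 e n, mem_elements (S.ratSpan_mem_seqs he) n⟩) ∈ S.seqs := by
  obtain ⟨φ, hφ, hT⟩ := h
  obtain ⟨f, hf, hfc⟩ := exists_const_index
  have hidx : ∀ n, IsIndex 𝕜 e (f n) (ratSpan 𝕜 e n) := fun n k => ⟨n, by simp [hfc], by simp⟩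
  choose d hd hd' using fun n => hT (f n) ⟨_, mem_elements (S.ratSpan_mem_seqs he) n⟩ (hidx n)
  have hdc : Computable d := (hφ.comp hf).of_eq_tot hd
  choose u hu hu' using hd'
  have huc : Computable fun p : ℕ => u p.unpair.1 p.unpair.2 :=
    Partrec.of_eq_tot (partrec_phi.comp (hdc.comp (Computable.fst.comp Computable.unpair))
      (Computable.snd.comp Computable.unpair)) fun p => hu _ _
  exact S.limit (fun n k => ratSpan 𝕜 e (u n k)) _ (seqs_comp (S.ratSpan_mem_seqs he) huc)
    ⟨Prod.snd, Computable.snd, fun n N k hk => (hu' n k).le.trans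
      (pow_le_pow_of_le_one (by norm_num) (by norm_num) hk)⟩

theorem IsEffective.isEffectivelyDetermined (h : S.IsEffective e T) (he : S.IsEGS e) :
    S.IsEffectivelyDetermined T := by
  refine ⟨fun n => ⟨e n, mem_elements he.1 n⟩, he, ?_⟩
  convert seqs_comp (h.ratSpan_mem_seqs he.1) computable_basisCode using 3 with n
  simp [ratSpan_basisCode]

/-- An effective operator is continuous along the rational span: otherwise a self-referential index
of `x` could switch to a rational point with a distant image as soon as the operator has committed
itself to an approximation of `T x`. -/
theorem IsEffective.exists_modulus (h : S.IsEffective e T) (he : S.IsEGS e) (x : S.elements)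
    (k : ℕ) : ∃ t : ℕ, ∀ m, ‖ratSpan 𝕜 e m - x‖ < (1 / 2) ^ t →
      ‖T ⟨ratSpan 𝕜 e m, mem_elements (S.ratSpan_mem_seqs he.1) m⟩ - T x‖ ≤ (1 / 2) ^ k := by
  by_contra! hcon
  have ha := S.ratSpan_mem_seqs he.1
  have hTa := h.ratSpan_mem_seqs he.1
  obtain ⟨φ, hφ, hT⟩ := h
  obtain ⟨g, hg, hgx⟩ := he.exists_approx x.2
  -- Computability of `T x` makes distances to it comparable with `2⁻ᵏ`, as both searches below
  -- require.
  have hTx : (fun _ : ℕ => T x) ∈ S.seqs := by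
    obtain ⟨f, hf, hfc⟩ := exists_index_computable (F := fun _ n => Part.some (g (0, n)))
      (hg.comp ((Computable.const 0).pair Computable.snd)).partrec.to₂
    have hidx : IsIndex 𝕜 e (f 0) x := fun n => ⟨g (0, n), by simp [hfc], hgx 0 n⟩
    obtain ⟨d, -, hd⟩ := hT _ _ hidx
    choose u hu hu' using hd
    have huc : Computable fun p : ℕ => u p.unpair.2 :=
      Partrec.of_eq_tot (partrec_phi.comp (Computable.const d)
        (Computable.snd.comp Computable.unpair)) fun p => hu _
    exact S.limit (fun _ k => ratSpan 𝕜 e (u k)) _ (seqs_comp ha huc)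
      ⟨Prod.snd, Computable.snd, fun n N k hk => (hu' k).le.trans
        (pow_le_pow_of_le_one (by norm_num) (by norm_num) hk)⟩
  obtain ⟨w, hw, hw'⟩ : ∃ w : ℕ → ℕ, Computable w ∧ ∀ t,
      ‖ratSpan 𝕜 e (w t) - x‖ < (1 / 2) ^ (t + 1) ∧ (1 / 2) ^ k <
        ‖T ⟨ratSpan 𝕜 e (w t), mem_elements ha (w t)⟩ - T x‖ := by
    refine IsSemidecidable.exists_computable (R := fun p : ℕ × ℕ =>
      ‖ratSpan 𝕜 e p.2 - x‖ < (1 / 2) ^ (p.1 + 1) ∧ (1 / 2) ^ k <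
        ‖T ⟨ratSpan 𝕜 e p.2, mem_elements ha p.2⟩ - T x‖) (.and ?_ ?_) fun t => hcon (t + 1)
    · exact (isComputableFamily_dist ha x.2).semidecidable_lt.comp
        (f := fun p : ℕ × ℕ => ((p.2, 0), p.1 + 1))
        ((Computable.snd.pair (Computable.const 0)).pair (Computable.succ.comp Computable.fst))
    · exact (isComputableFamily_dist hTa hTx).semidecidable_gt.comp
        (f := fun p : ℕ × ℕ => ((p.2, 0), k))
        ((Computable.snd.pair (Computable.const 0)).pair (Computable.const k))
  -- The event that triggers the switch: the index `φ c` is defined and its approximation of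
  -- precision `k + 1` lies near `T x`.
  have hsemi : IsSemidecidable fun c : Nat.Partrec.Code =>
      ∃ v ∈ (φ (Encodable.encode c)).bind fun d => phi d (k + 1),
        ‖ratSpan 𝕜 e v - T x‖ < (1 / 2) ^ (k + 1) := by
    refine IsSemidecidable.exists_mem (Q := fun v => ‖ratSpan 𝕜 e v - T x‖ < (1 / 2) ^ (k + 1))
      ((isComputableFamily_dist ha hTx).semidecidable_lt.comp
        (f := fun v : ℕ => ((v, 0), k + 1))
        ((Computable.id.pair (Computable.const 0)).pair (Computable.const (k + 1)))) ?_
    exact (hφ.comp Computable.encode).bind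
      (partrec_phi.comp Computable.snd (Computable.const (k + 1))).to₂
  obtain ⟨D, hD, hDs⟩ := hsemi
  let out : Nat.Partrec.Code → ℕ → ℕ := fun c n =>
    (firstStage (fun s => D (c, s)) n).casesOn (g (0, n + 1)) w
  have hout : Computable fun p : Nat.Partrec.Code × ℕ => out p.1 p.2 :=
    Computable.option_casesOn (computable_firstStage hD)
      (hg.comp ((Computable.const 0).pair (Computable.succ.comp Computable.snd)))
      (hw.comp Computable.snd).to₂
  -- The recursion theorem lets the program watch the operator act on its own code.
  obtain ⟨c, hc⟩ := Nat.Partrec.Code.fixed_point₂ (f := fun c n => Part.some (out c n))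
    hout.partrec.to₂
  have hphi : ∀ n, phi (Encodable.encode c) n = Part.some (out c n) := fun n => by
    simp [phi, hc]
  have hhalf : ∀ n : ℕ, (1 / 2 : ℝ) ^ (n + 1) + (1 / 2) ^ (n + 1) = (1 / 2) ^ n := fun n => by
    ring
  -- Without the event `c` would remain an index of `x`, so the operator would have to approximate
  -- `T x`, which is the event.
  have hevent : ∃ s, D (c, s) = true := by
    by_contra! hno
    have hnone : ∀ n, firstStage (fun s => D (c, s)) n = none := fun n => by
      cases h' : firstStage (fun s => D (c, s)) n with
      | none => rfl
      | some t => exact absurd (firstStage_lt h').2.1 (hno t)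
    have hidx : IsIndex 𝕜 e (Encodable.encode c) x := fun n => by
      refine ⟨g (0, n + 1), by rw [hphi]; simp [out, hnone], (hgx 0 (n + 1)).trans ?_⟩
      exact pow_lt_pow_right_of_lt_one₀ (by norm_num) (by norm_num) (Nat.lt_succ_self n)
    obtain ⟨d, hd, hd'⟩ := hT _ _ hidx
    obtain ⟨v, hv, hv'⟩ := hd' (k + 1)
    obtain ⟨s, hs⟩ := (hDs c).1 ⟨v, Part.mem_bind hd hv, hv'⟩
    exact hno s hs
  obtain ⟨v, hv, hvx⟩ := (hDs c).2 hevent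
  obtain ⟨s, hs⟩ := hevent
  obtain ⟨t, ht⟩ := exists_firstStage (D := fun s => D (c, s)) hs
  obtain ⟨-, -, ht⟩ := firstStage_lt ht
  -- Outputs before the switch, at `n ≤ t`, remain valid: they and the new point `w t` are both
  -- within `2⁻⁽ⁿ⁺¹⁾` of `x`. Later outputs are exact.
  have hidx : IsIndex 𝕜 e (Encodable.encode c) (ratSpan 𝕜 e (w t)) := fun n => by
    refine ⟨out c n, by simp [hphi], ?_⟩
    cases h' : firstStage (fun s => D (c, s)) n with
    | none =>
      have hnt : n ≤ t := by
        by_contra hlt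
        rw [firstStage_of_le ht (not_le.1 hlt)] at h'
        simp at h'
      have h1 : out c n = g (0, n + 1) := by simp [out, h']
      rw [h1]
      have h2 := norm_sub_le_norm_sub_add_norm_sub (ratSpan 𝕜 e (g (0, n + 1))) (x : X)
        (ratSpan 𝕜 e (w t))
      rw [norm_sub_rev (x : X)] at h2
      have h3 : (1 / 2 : ℝ) ^ (t + 1) ≤ (1 / 2) ^ (n + 1) :=
        pow_le_pow_of_le_one (by norm_num) (by norm_num) (Nat.succ_le_succ hnt)
      linarith [hgx 0 (n + 1), (hw' t).1, hhalf n]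
    | some t' =>
      obtain rfl : t' = t := by
        have h1 := firstStage_of_le h' (le_max_left n (t + 1))
        rw [firstStage_of_le ht (le_max_right n (t + 1))] at h1
        simpa using h1.symm
      have h1 : out c n = w t' := by simp [out, h']
      rw [h1, sub_self, norm_zero]
      positivity
  obtain ⟨d, hd, hd'⟩ := hT _ ⟨_, mem_elements ha (w t)⟩ hidx
  obtain ⟨v', hv', hvT⟩ := hd' (k + 1)
  -- The same output `v` is within `2⁻⁽ᵏ⁺¹⁾` of both `T x` and the image of the new point, whose
  -- distance exceeds `2⁻ᵏ`.
  obtain rfl := Part.mem_unique hv (Part.mem_bind hd hv')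
  have h2 := norm_sub_le_norm_sub_add_norm_sub (T ⟨_, mem_elements ha (w t)⟩)
    (ratSpan 𝕜 e v) (T x)
  rw [norm_sub_rev _ (ratSpan 𝕜 e v)] at h2
  linarith [(hw' t).2, hhalf k]

/-- `exists_modulus` compares only with rational points; an arbitrary `y` near `x` is reached
through a rational point so close to `y` that it satisfies the moduli at both `y` and `x`. -/
theorem IsEffective.continuous (h : S.IsEffective e T) (he : S.IsEGS e) : Continuous T := by
  rw [Metric.continuous_iff]
  intro x ε hε
  obtain ⟨k, hk⟩ := exists_pow_lt_of_lt_one (half_pos hε) (show (1 / 2 : ℝ) < 1 by norm_num)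
  obtain ⟨t, ht⟩ := h.exists_modulus he x k
  refine ⟨(1 / 2) ^ t, by positivity, fun y hy => ?_⟩
  obtain ⟨s, hs⟩ := h.exists_modulus he y k
  rw [Subtype.dist_eq, dist_eq_norm] at hy
  obtain ⟨m, hm⟩ := exists_ratSpan_near he.2 (y : X)
    (lt_min (show (0 : ℝ) < (1 / 2) ^ s by positivity) (sub_pos.2 hy))
  have h1 := hs m (hm.trans_le (min_le_left _ _))
  have h2 := ht m (by
    linarith [norm_sub_le_norm_sub_add_norm_sub (ratSpan 𝕜 e m) (y : X) (x : X),
      hm.trans_le (min_le_right _ _)])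
  rw [dist_eq_norm]
  have h3 := norm_sub_le_norm_sub_add_norm_sub (T y)
    (T ⟨_, mem_elements (S.ratSpan_mem_seqs he.1) m⟩) (T x)
  rw [norm_sub_rev] at h1
  linarith

/-! ### Continuous, effectively determined linear operators are effective. -/

theorem elements_add {x y : X} (hx : x ∈ S.elements) (hy : y ∈ S.elements) :
    x + y ∈ S.elements := by
  -- The sum is obtained as `x - ((x - x) - y)`.
  have h := seqs_sub hx (seqs_sub (seqs_sub hx hx) hy)
  simpa [elements] using h

theorem elements_sub {x y : X} (hx : x ∈ S.elements) (hy : y ∈ S.elements) :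
    x - y ∈ S.elements :=
  seqs_sub hx hy

theorem elements_smul {x : X} (hx : x ∈ S.elements) (n : ℕ) :
    scalarOfNat 𝕜 n • x ∈ S.elements := by
  have h := S.linear_combination _ hx _ hx _ _
    (isComputableFamily_scalarOfNat (Computable.const n))
    (isComputableFamily_scalarOfNat (Computable.const 0)) (fun _ => 0) (Computable.const 0)
  simpa [elements, scalarOfNat_zero] using h

theorem IsLinear.map_zero (hT : S.IsLinear T) {z : S.elements} (hz : (z : X) = 0) : T z = 0 := by
  have h := hT.add z z z (by simp [hz])
  simpa using h

theorem IsLinear.map_sub (hT : S.IsLinear T) (x y z : S.elements) (h : (z : X) = x - y) :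
    T z = T x - T y :=
  eq_sub_of_add_eq (hT.add z y x (by simp [h])).symm

theorem IsLinear.map_sum (hT : S.IsLinear T) (e : ℕ → S.elements) (c : ℕ → ℕ) (N : ℕ) :
    ∃ h : ∑ j ∈ Finset.range N, scalarOfNat 𝕜 (c j) • (e j : X) ∈ S.elements,
      T ⟨_, h⟩ = ∑ j ∈ Finset.range N, scalarOfNat 𝕜 (c j) • T (e j) := by
  induction N with
  | zero =>
    have h0 : (0 : X) ∈ S.elements := by simpa using elements_sub (e 0).2 (e 0).2
    exact ⟨by simpa using h0, by simpa using hT.map_zero (by simp)⟩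
  | succ N ih =>
    obtain ⟨h, hN⟩ := ih
    have hs := elements_smul (e N).2 (c N)
    refine ⟨by rw [Finset.sum_range_succ]; exact elements_add h hs, ?_⟩
    rw [Finset.sum_range_succ (fun j => scalarOfNat 𝕜 (c j) • T (e j)), ← hN,
      ← hT.smul _ (e N) ⟨_, hs⟩ (isComputableScalar_scalarOfNat (c N)) rfl]
    exact hT.add _ _ _ (by simp [Finset.sum_range_succ])

/-- Repeated doubling needs only additivity, and it supplies the rescaling for `exists_bound`. -/
theorem IsLinear.map_two_pow (hT : S.IsLinear T) (x : S.elements) (n : ℕ) :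
    ∃ z : S.elements, (z : X) = 2 ^ n • (x : X) ∧ T z = 2 ^ n • T x := by
  induction n with
  | zero => exact ⟨x, by simp, by simp⟩
  | succ n ih =>
    obtain ⟨z, hz, hTz⟩ := ih
    refine ⟨⟨z + z, elements_add z.2 z.2⟩, ?_, ?_⟩
    · simp only [hz, pow_succ, mul_two, add_smul]
    · rw [hT.add z z _ rfl, hTz, pow_succ, mul_two, add_smul]

/-- A continuous linear operator on the computable elements is bounded. -/
theorem IsLinear.exists_bound (hT : S.IsLinear T) (hc : Continuous T) :
    ∃ s : ℕ, ∀ (n : ℕ) (x : S.elements), ‖(x : X)‖ < (1 / 2) ^ (n + s) →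
      ‖T x‖ ≤ (1 / 2) ^ n := by
  obtain ⟨y, hy⟩ := S.nonempty
  have h0 : (0 : X) ∈ S.elements := by
    simpa using elements_sub (mem_elements hy 0) (mem_elements hy 0)
  obtain ⟨δ, hδ, hδ'⟩ := Metric.continuous_iff.1 hc ⟨0, h0⟩ 1 one_pos
  obtain ⟨s, hs⟩ := exists_pow_lt_of_lt_one hδ (show (1 / 2 : ℝ) < 1 by norm_num)
  refine ⟨s, fun n x hx => ?_⟩
  obtain ⟨z, hz, hTz⟩ := hT.map_two_pow x n
  have e1 : (1 / 2 : ℝ) ^ n * 2 ^ n = 1 := by rw [← mul_pow]; norm_num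
  have hnorm : ∀ v : X, ‖(2 ^ n : ℕ) • v‖ = 2 ^ n * ‖v‖ := fun v => by
    rw [← Nat.cast_smul_eq_nsmul 𝕜, norm_smul]; simp
  have hzs : ‖(z : X)‖ < δ := by
    rw [hz, hnorm]
    refine lt_trans ?_ hs
    calc (2 : ℝ) ^ n * ‖(x : X)‖ < 2 ^ n * (1 / 2) ^ (n + s) :=
          mul_lt_mul_of_pos_left hx (by positivity)
      _ = (1 / 2) ^ s := by rw [pow_add]; linear_combination (1 / 2 : ℝ) ^ s * e1
  have h1 := hδ' z (by rw [Subtype.dist_eq, dist_eq_norm]; simpa using hzs)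
  rw [hT.map_zero (z := ⟨0, h0⟩) rfl, dist_zero_right, hTz, hnorm] at h1
  have h2 := mul_le_mul_of_nonneg_left h1.le (show (0 : ℝ) ≤ (1 / 2) ^ n by positivity)
  calc ‖T x‖ = (1 / 2) ^ n * (2 ^ n * ‖T x‖) := by rw [← mul_assoc, e1, one_mul]
    _ ≤ (1 / 2) ^ n := by simpa using h2

theorem IsLinear.isEffective (hT : S.IsLinear T) (he : S.IsEGS e)
    (hd : S.IsEffectivelyDetermined T) (hc : Continuous T) : S.IsEffective e T := by
  obtain ⟨e', he', hTe'⟩ := hd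
  obtain ⟨s, hs⟩ := hT.exists_bound hc
  -- `g` translates rational combinations of `e` into ones of `e'`; `w` approximates the images of
  -- the latter by rational combinations of `e`.
  obtain ⟨g, hg, hga⟩ := he'.exists_approx (S.ratSpan_mem_seqs he.1)
  obtain ⟨w, hw, hwT⟩ := he.exists_approx (S.ratSpan_mem_seqs hTe')
  have hb := mem_elements (S.ratSpan_mem_seqs he'.1)
  have hTb : ∀ m, T ⟨_, hb m⟩ = ratSpan 𝕜 (fun n => T (e' n)) m := fun m =>
    (hT.map_sum e' (fun j => (Denumerable.ofNat (List ℕ) m).getD j 0) _).2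
  -- Precision `n + s + 2` makes the index error and the translation error together less than
  -- `2⁻⁽ⁿ⁺¹⁺ˢ⁾`, so the image error is at most `2⁻⁽ⁿ⁺¹⁾`; the other half of `2⁻ⁿ` is left for `w`.
  have hin : Computable fun p : ℕ × ℕ => p.2 + (s + 2) :=
    Primrec.nat_add.to_comp.comp Computable.snd (Computable.const _)
  have hpost : Computable fun q : (ℕ × ℕ) × ℕ => w (g (q.2, q.1.2 + (s + 2)), q.1.2 + 1) :=
    hw.comp ((hg.comp (Computable.snd.pair (hin.comp Computable.fst))).pair
      (Computable.succ.comp (Computable.snd.comp Computable.fst)))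
  have hF : Partrec₂ fun c n : ℕ =>
      (phi c (n + (s + 2))).map fun u => w (g (u, n + (s + 2)), n + 1) :=
    Partrec.map (partrec_phi.comp Computable.fst hin) hpost.to₂
  obtain ⟨f, hf, hfc⟩ := exists_index_computable hF
  refine ⟨fun c => Part.some (f c), hf.partrec, fun c x hx => ⟨f c, Part.mem_some _, fun n => ?_⟩⟩
  obtain ⟨u, hu, hux⟩ := hx (n + (s + 2))
  refine ⟨w (g (u, n + (s + 2)), n + 1), by rw [hfc]; exact Part.mem_map _ hu, ?_⟩
  have h1 := hga u (n + (s + 2))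
  have h2 := hwT (g (u, n + (s + 2))) (n + 1)
  have h3 : ‖ratSpan 𝕜 (fun n => (e' n : X)) (g (u, n + (s + 2))) - x‖ <
      (1 / 2) ^ (n + 1 + s) := by
    refine (norm_sub_le_norm_sub_add_norm_sub _ (ratSpan 𝕜 e u) _).trans_lt ?_
    have h4 : (1 / 2 : ℝ) ^ (n + 1 + s) = (1 / 2) ^ (n + (s + 2)) + (1 / 2) ^ (n + (s + 2)) := by
      ring
    linarith
  have h4 := hs (n + 1) ⟨_, elements_sub (hb _) x.2⟩ h3
  rw [hT.map_sub ⟨_, hb _⟩ x _ rfl, hTb] at h4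
  refine (norm_sub_le_norm_sub_add_norm_sub _ _ _).trans_lt (add_lt_add_of_lt_of_le h2 h4)
    |>.trans_eq ?_
  ring

end ComputabilityStructure

end EffBanach

theorem theorem42 {𝕜 : Type*} [RCLike 𝕜] {X : Type*} [NormedAddCommGroup X] [NormedSpace 𝕜 X]
    [CompleteSpace X] (S : EffBanach.ComputabilityStructure 𝕜 X) (e : ℕ → X) (he : S.IsEGS e)
    (T : S.elements → X) (hT : S.IsLinear T) :
    S.IsEffective e T ↔ S.IsEffectivelyDetermined T ∧ Continuous T :=
  ⟨fun h => ⟨h.isEffectivelyDetermined he, h.continuous he⟩,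
    fun h => hT.isEffective he h.1 h.2⟩
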